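/- **Setting.** Let $K^{m,n}$ be the cubical complex of all cells $[a,b]\times[a',b']$ (with integer corners and side lengths $0$ or $1$) contained in $[1,m]\times[1,n]$. For $I\in\mathbb{R}^{m\times n}$ let $f_I:K^{m,n}\to\mathbb{R}$ be the maximum of the entries of $I$ at the vertices of a cell, let $D(I)_r=\{f_I\le r\}$, and let $H_*(I)$ be the persistent homology of $(D(I)_r)_{r\in\mathbb{R}}$ with coefficients in $\mathbb{F}_2$. A compatible ordering for $I$ is a total ordering of the cells along which $f_I$ is non-decreasing and in which the faces of a cell precede it. For compatible orderings for $I$ and for $J$, let $\mathrm{Red}(I,J)$ be the set of pairs $(c,d)$ of cells such that, after the standard column reduction over $\mathbb{F}_2$ of the boundary matrix of $K^{m,n}$ with rows ordered for $I$ and columns ordered for $J$, the lowest non-zero entry of the column of $d$ is in the row of $c$. The barcode $\mathcal B(I)$ consists of an interval $[f_I(c),f_I(d))$ for each $(c,d)\in\mathrm{Red}(I,I)$ with $f_I(c)<f_I(d)$, and an essential interval $[f_I(c),\infty)$ for each cell $c$ in no pair of $\mathrm{Red}(I,I)$. For $I\ge J$ the induced matching $\sigma(I,J):\mathcal B(I)\to\mathcal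 B(J)$ matches the finite interval of $(c,d')$ with the finite interval of $(c',d)$ if $(c,d)\in\mathrm{Red}(I,J)$, and it matches the essential intervals with each other (in each degree by order of birth; in fact there is at most one essential interval, of degree $0$). For images $L,G$ with entries in $[0,1]$ let $C=\min(L,G)$ entrywise; the Betti matching is $\tau(L,G)=\sigma(G,C)^{-1}\circ\sigma(L,C)$. An interval $[a,b)$ is represented by the point $(a,b)$; an essential interval $[a,\infty)$ is replaced by $[a,1]$ and represented by $(a,1)$. The persistence diagram $\mathrm{Dgm}(I)$ consists of the points so obtained that lie strictly above the diagonal (with multiplicity; so the degenerate interval $[1,1]$ gives no off-diagonal point, and an interval matched with it counts as unmatched), together with all points of the diagonal with infinite multiplicity. The matching $\tau(L,G)$, restricted to pairs of off-diagonal points, is regarded as a bijection $\mathrm{Dgm}(L)\to\mathrm{Dgm}(G)$ that pairs each unmatched point of either diagram with its closest point on the diagonal and does not move the remaining diagonal points. Let $\ker\tau(L,G)$ and $\mathrm{coker}\,\tau(L,G)$ be the multisets of unmatched off-diagonal points of $\mathrm{Dgm}(L)$ and of $\mathrm{Dgm}(G)$. The Betti matching loss is $$l_{\mathrm{BM}}(L,G)=\sum_{q\in\mathrm{Dgm}(L)}2\,\|q-\tau(L,G)(q)\|_2^2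 .$$ **Statement.** Let $P,G\in\{0,1\}^{m\times n}$ and let any compatible orderings for $P$, $G$ and $\min(P,G)$ be given. Then: 1. $\mathcal B(P)$ and $\mathcal B(G)$ are the barcodes of the persistence modules $H_*(P)$ and $H_*(G)$, that is, each of these modules is isomorphic to the direct sum of the interval modules of its barcode. 2. Every off-diagonal point of $\mathrm{Dgm}(P)$ and of $\mathrm{Dgm}(G)$ is $(0,1)$, and its multiplicity is the number of topological features of the image, $\dim_{\mathbb{F}_2}H_*(D(P)_0)$ and $\dim_{\mathbb{F}_2}H_*(D(G)_0)$ respectively. 3. $\tau(P,G)$ is a matching (each interval has at most one partner). In the loss $l_{\mathrm{BM}}(P,G)$ every unmatched off-diagonal point of either diagram contributes exactly $1$, and every matched pair of off-diagonal points contributes $0$. 4. The Betti matching error $\tau^{\mathrm{err}}(P,G):=l_{\mathrm{BM}}(P,G)$ is well defined (a bijection as above exists and the value does not depend on its choice), and $$\tau^{\mathrm{err}}(P,G)=\#\ker\tau(P,G)+\#\,\mathrm{coker}\,\tau(P,G)\in\mathbb{N}_0 .$$ -/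

import Mathlib

noncomputable section

namespace BettiMatching

/-! ### The cubical grid complex -/

/-- A (possibly degenerate) elementary interval `[a, b]` with `b ∈ {a, a + 1}` whose end points are
two of the `m` grid positions. -/
abbrev GridInterval (m : ℕ) : Type :=
  {p : Fin m × Fin m // (p.2 : ℕ) = p.1 ∨ (p.2 : ℕ) = p.1 + 1}

/-- The cells of the cubical grid complex `K^{m,n}`: products of two elementary intervals. -/
abbrev Cell (m n : ℕ) : Type := GridInterval m × GridInterval n

variable {m n : ℕ}

/-- Inclusion of elementary intervals. -/
def GridInterval.Sub (s t : GridInterval m) : Prop := t.1.1 ≤ s.1.1 ∧ s.1.2 ≤ t.1.2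

/-- `c` is a face of `d`, that is, `c ⊆ d`. -/
def Cell.IsFace (c d : Cell m n) : Prop :=
  GridInterval.Sub c.1 d.1 ∧ GridInterval.Sub c.2 d.2

/-- The dimension of a cell: the number of its non-degenerate intervals. -/
def Cell.dim (c : Cell m n) : ℕ :=
  (if c.1.1.1 = c.1.1.2 then 0 else 1) + (if c.2.1.1 = c.2.1.2 then 0 else 1)

/-- A facet is a face of codimension one. -/
def Cell.IsFacet (c d : Cell m n) : Prop := c.IsFace d ∧ d.dim = c.dim + 1

instance (c d : Cell m n) : Decidable (c.IsFace d) := by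
  unfold Cell.IsFace GridInterval.Sub; infer_instance

instance (c d : Cell m n) : Decidable (c.IsFacet d) := by
  unfold Cell.IsFacet; infer_instance

/-- The filter function of an image (V-construction): the maximum of the entries at the vertices
of the cell. The vertices of `[a, b] × [a', b']` are its (possibly coinciding) four corners. -/
def filterFunction (I : Matrix (Fin m) (Fin n) ℝ) (c : Cell m n) : ℝ :=
  max (max (I c.1.1.1 c.2.1.1) (I c.1.1.1 c.2.1.2)) (max (I c.1.1.2 c.2.1.1) (I c.1.1.2 c.2.1.2))

/-- The sublevel set `D(I)_r` of the grid complex. -/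
def sublevel (I : Matrix (Fin m) (Fin n) ℝ) (r : ℝ) : Set (Cell m n) :=
  {c | filterFunction I c ≤ r}

/-! ### Homology with coefficients in `𝔽₂` -/

/-- The chains of the whole grid complex, in all degrees together. -/
abbrev Chain (m n : ℕ) : Type := Cell m n → ZMod 2

/-- The boundary map: a cell is sent to the sum of its facets. -/
def boundary (m n : ℕ) : Chain m n →ₗ[ZMod 2] Chain m n :=
  Matrix.toLin' (Matrix.of fun c d : Cell m n => if c.IsFacet d then (1 : ZMod 2) else 0)

/-- The chains supported in a set of cells. -/
def chains (S : Set (Cell m n)) : Submodule (ZMod 2) (Chain m n) where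
  carrier := {x | ∀ c, c ∉ S → x c = 0}
  add_mem' hx hy c hc := by simp [hx c hc, hy c hc]
  zero_mem' c _ := rfl
  smul_mem' a x hx c hc := by simp [hx c hc]

/-- The cycles supported in a set of cells. -/
def cycles (S : Set (Cell m n)) : Submodule (ZMod 2) (Chain m n) :=
  chains S ⊓ LinearMap.ker (boundary m n)

/-- The boundaries of the chains supported in a set of cells. -/
def boundaries (S : Set (Cell m n)) : Submodule (ZMod 2) (Chain m n) :=
  (chains S).map (boundary m n)

/-- The homology `H_*(S) = ⨁_d H_d(S)` of a subcomplex `S`: cycles modulo boundaries. -/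
abbrev Homology (S : Set (Cell m n)) : Type :=
  cycles S ⧸ (boundaries S).submoduleOf (cycles S)

theorem chains_mono {S T : Set (Cell m n)} (h : S ⊆ T) : chains S ≤ chains T :=
  fun _ hx c hc => hx c fun hS => hc (h hS)

theorem cycles_mono {S T : Set (Cell m n)} (h : S ⊆ T) : cycles S ≤ cycles T :=
  inf_le_inf_right _ (chains_mono h)

theorem boundaries_le_comap {S T : Set (Cell m n)} (h : S ⊆ T) :
    (boundaries S).submoduleOf (cycles S) ≤
      ((boundaries T).submoduleOf (cycles T)).comap (Submodule.inclusion (cycles_mono h)) :=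
  fun _ hx => Submodule.map_mono (chains_mono h) hx

/-- The map in homology induced by an inclusion of subcomplexes. -/
def homologyMap {S T : Set (Cell m n)} (h : S ⊆ T) : Homology S →ₗ[ZMod 2] Homology T :=
  Submodule.mapQ _ _ (Submodule.inclusion (cycles_mono h)) (boundaries_le_comap h)

/-! ### Persistence modules and their barcodes -/

/-- A persistence module over `𝔽₂`, indexed by the real numbers. -/
structure PersistenceModule where
  /-- The vector spaces. -/
  V : ℝ → Type
  [grp : ∀ r, AddCommGroup (V r)]
  [mod : ∀ r, Module (ZMod 2) (V r)]
  /-- The transition maps. -/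
  map : ∀ {r s : ℝ}, r ≤ s → V r →ₗ[ZMod 2] V s
  map_id : ∀ r, map (le_refl r) = LinearMap.id
  map_comp : ∀ {r s t : ℝ} (h : r ≤ s) (h' : s ≤ t), map h' ∘ₗ map h = map (h.trans h')

attribute [instance] PersistenceModule.grp PersistenceModule.mod

/-- The family `J` of intervals is a barcode of `M`, that is, `M` is isomorphic to the direct sum of
the interval modules `C(J i)`. At `r` this direct sum is the vector space with one basis vector for
each `i` with `r ∈ J i`; its transition map to `s` sends the basis vector of `i` to the basis vector
of `i` if `s ∈ J i`, and to zero otherwise. An isomorphism is thus a choice of such bases. -/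
def PersistenceModule.IsBarcode (M : PersistenceModule) {ι : Type} (J : ι → Set ℝ) : Prop :=
  (∀ i, (J i).Nonempty ∧ (J i).OrdConnected) ∧
  ∃ b : ∀ r : ℝ, Module.Basis {i // r ∈ J i} (ZMod 2) (M.V r),
    ∀ (r s : ℝ) (h : r ≤ s) (i : {i // r ∈ J i}),
      (∀ hs : s ∈ J i, M.map h (b r i) = b s ⟨i, hs⟩) ∧ (s ∉ J i → M.map h (b r i) = 0)

theorem sublevel_mono (I : Matrix (Fin m) (Fin n) ℝ) {r s : ℝ} (h : r ≤ s) :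
    sublevel I r ⊆ sublevel I s :=
  fun _ hc => le_trans hc h

/-- The persistent homology `H_*(I)` of (the sublevel filtration of) an image. -/
def persistentHomology (I : Matrix (Fin m) (Fin n) ℝ) : PersistenceModule where
  V r := Homology (sublevel I r)
  map h := homologyMap (sublevel_mono I h)
  map_id r := by
    apply LinearMap.ext
    intro x
    obtain ⟨x, rfl⟩ := Submodule.Quotient.mk_surjective _ x
    rfl
  map_comp h h' := by
    apply LinearMap.ext
    intro x
    obtain ⟨x, rfl⟩ := Submodule.Quotient.mk_surjective _ x
    rfl

/-! ### The matrix reduction -/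

/-- The index of the lowest non-zero entry of a column, and `⊥` for the zero column. -/
def low {N : ℕ} (v : Fin N → ZMod 2) : WithBot (Fin N) :=
  (Finset.univ.filter fun i => v i ≠ 0).max

/-- One step of the reduction of the `j`-th column, with current value `v`: if `v ≠ 0` and there is
a column to the left of the `j`-th one with the same lowest non-zero entry, then it is added. -/
def reduceStep {N : ℕ} (R : Fin N → Fin N → ZMod 2) (j : Fin N) (v : Fin N → ZMod 2) :
    Fin N → ZMod 2 :=
  match (List.finRange N).find? fun k => decide (k < j ∧ low v ≠ ⊥ ∧ low (R k) = low v) with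
  | some k => v + R k
  | none => v

/-- The standard column reduction of a square matrix over `𝔽₂`, given by its columns: the columns
are treated from left to right, and each is reduced by the previous ones until no step applies.
Each step that applies decreases the index of the lowest entry, so `N` steps are enough. -/
def reduce {N : ℕ} (B : Fin N → Fin N → ZMod 2) : Fin N → Fin N → ZMod 2 :=
  (List.finRange N).foldl (fun R j => Function.update R j ((reduceStep R j)^[N] (R j))) B

/-- An ordering `c₁, …, c_l` of the cells that is compatible with the filtration of the image `I`:
it refines the sublevel filtration, and the faces of a cell precede the cell. -/
structure CompatibleOrdering (I : Matrix (Fin m) (Fin n) ℝ) where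
  /-- The position of a cell. -/
  pos : Cell m n ≃ Fin (Fintype.card (Cell m n))
  pos_lt_of_lt : ∀ c d, filterFunction I c < filterFunction I d → pos c < pos d
  pos_lt_of_isFace : ∀ c d, c.IsFace d → c ≠ d → pos c < pos d

variable {I J L G : Matrix (Fin m) (Fin n) ℝ}

/-- The columns of the boundary matrix of the grid complex, with the rows indexed by a compatible
ordering for `I` and the columns indexed by a compatible ordering for `J`. -/
def boundaryMatrix (o : CompatibleOrdering I) (o' : CompatibleOrdering J) :
    Fin (Fintype.card (Cell m n)) → Fin (Fintype.card (Cell m n)) → ZMod 2 :=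
  fun j i => if (o.pos.symm i).IsFacet (o'.pos.symm j) then 1 else 0

/-- The pairs `(c, d)` obtained by the reduction of the boundary matrix with rows ordered for `I` and
columns ordered for `J`: the row of `c` contains the lowest non-zero entry of the reduced column of
`d`. For `I = J` these are the persistence pairs of `I`. For `I ≥ J` they are the image persistence
pairs, with `f_I(c) < f_J(d)`, and the reverse persistence pairs, with `f_I(c) ≥ f_J(d)`. -/
def IsPair (o : CompatibleOrdering I) (o' : CompatibleOrdering J) (c d : Cell m n) : Prop :=
  low (reduce (boundaryMatrix o o') (o'.pos d)) = (o.pos c : WithBot _)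

/-! ### Barcodes of images -/

/-- The persistence pairs of positive length, which index the finite intervals of the barcode. -/
abbrev FiniteBar (o : CompatibleOrdering I) : Type :=
  {p : Cell m n × Cell m n //
    IsPair o o p.1 p.2 ∧ filterFunction I p.1 < filterFunction I p.2}

/-- The singletons: cells in no persistence pair. They index the essential intervals. -/
abbrev EssentialBar (o : CompatibleOrdering I) : Type :=
  {c : Cell m n // ∀ d, ¬ IsPair o o c d ∧ ¬ IsPair o o d c}

/-- The (underlying set of the) barcode of the image, indexed by the refined intervals. -/
abbrev Barcode (o : CompatibleOrdering I) : Type := FiniteBar o ⊕ EssentialBar o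

/-- The interval `[f_I(c), f_I(d))` or `[f_I(c), ∞)` that belongs to an index of the barcode. -/
def Barcode.interval {o : CompatibleOrdering I} : Barcode o → Set ℝ
  | .inl p => Set.Ico (filterFunction I p.1.1) (filterFunction I p.1.2)
  | .inr c => Set.Ici (filterFunction I c.1)

/-- The point of the plane that belongs to an interval of the barcode, where an essential interval
`[a, ∞)` is replaced by `[a, 1]`. -/
def Barcode.point {o : CompatibleOrdering I} : Barcode o → EuclideanSpace ℝ (Fin 2)
  | .inl p => !₂[filterFunction I p.1.1, filterFunction I p.1.2]
  | .inr c => !₂[filterFunction I c.1, 1]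

/-! ### The Betti matching -/

/-- The number of essential intervals in the degree of `c` that are born before `c`. -/
def essentialRank (o : CompatibleOrdering I) (c : Cell m n) : ℕ :=
  {e : EssentialBar o | e.1.dim = c.dim ∧ o.pos e.1 < o.pos c}.ncard

/-- The induced matching `σ(I, J)` of images `I ≥ J`. A finite interval of `I` born by `c` is matched
with the finite interval of `J` killed by `d` if `(c, d)` is an image persistence pair or a reverse
persistence pair. The essential intervals, which all have the right end point `∞`, are matched in
each degree in the order of their births (in the grid complex there is just one, of degree 0). -/
def inducedMatching (o : CompatibleOrdering I) (o' : CompatibleOrdering J) :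
    Barcode o → Barcode o' → Prop
  | .inl p, .inl q => IsPair o o' p.1.1 q.1.2
  | .inr c, .inr d => c.1.dim = d.1.dim ∧ essentialRank o c.1 = essentialRank o' d.1
  | _, _ => False

/-- The comparison image: the entrywise minimum. -/
def comparison (L G : Matrix (Fin m) (Fin n) ℝ) : Matrix (Fin m) (Fin n) ℝ :=
  Matrix.of fun i j => min (L i j) (G i j)

/-- The Betti matching `τ(L, G) = σ(G, C)⁻¹ ∘ σ(L, C)` with `C = min(L, G)`. -/
def bettiMatching (oL : CompatibleOrdering L) (oG : CompatibleOrdering G)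
    (oC : CompatibleOrdering (comparison L G)) (a : Barcode oL) (b : Barcode oG) : Prop :=
  ∃ c : Barcode oC, inducedMatching oL oC a c ∧ inducedMatching oG oC b c

/-! ### Persistence diagrams and the Betti matching loss -/

/-- The off-diagonal points of the persistence diagram, with multiplicity: the intervals of the
barcode whose point lies above the diagonal. (For an image with entries in `[0, 1]`, the only
interval that is left out is the essential interval of the constant image with value `1`, which is
replaced by the degenerate interval `[1, 1]`.) -/
abbrev DiagramPoint (o : CompatibleOrdering I) : Type :=
  {b : Barcode o // b.point 0 < b.point 1}

/-- The persistence diagram: the off-diagonal points and all points `(x, x)` with infinite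
multiplicity; the `k`-th copy of `(x, x)` is `Sum.inr (x, k)`. -/
abbrev Diagram (o : CompatibleOrdering I) : Type := DiagramPoint o ⊕ (ℝ × ℕ)

/-- The position in the plane of a point of the persistence diagram. -/
def Diagram.point {o : CompatibleOrdering I} : Diagram o → EuclideanSpace ℝ (Fin 2)
  | .inl q => q.1.point
  | .inr x => !₂[x.1, x.1]

/-- The mean of the coordinates of `(a, b)`; the closest point to `(a, b)` on the diagonal has both
coordinates equal to it. -/
def DiagramPoint.mid {o : CompatibleOrdering I} (q : DiagramPoint o) : ℝ :=
  (q.1.point 0 + q.1.point 1) / 2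

/-- The Betti matching between the off-diagonal points of the persistence diagrams. -/
def diagramMatching (oL : CompatibleOrdering L) (oG : CompatibleOrdering G)
    (oC : CompatibleOrdering (comparison L G)) (q : DiagramPoint oL) (q' : DiagramPoint oG) : Prop :=
  bettiMatching oL oG oC q.1 q'.1

/-- The kernel of a matching: the unmatched elements of the domain. -/
def matchingKer {X Y : Type} (τ : X → Y → Prop) : Set X := {x | ∀ y, ¬ τ x y}

/-- The cokernel of a matching: the unmatched elements of the codomain. -/
def matchingCoker {X Y : Type} (τ : X → Y → Prop) : Set Y := {y | ∀ x, ¬ τ x y}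

/-- `e` is a bijection of persistence diagrams that corresponds to the matching `τ` of their
off-diagonal points: it agrees with `τ` on the matched points, it pairs every unmatched point of
either diagram with a copy of its closest point on the diagonal, and it does not move the remaining
points of the diagonal (it may permute the copies of the same point). -/
structure IsDiagramBijection {oL : CompatibleOrdering L} {oG : CompatibleOrdering G}
    (τ : DiagramPoint oL → DiagramPoint oG → Prop) (e : Diagram oL ≃ Diagram oG) : Prop where
  matched : ∀ q q', τ q q' → e (.inl q) = .inl q'
  unmatched_left : ∀ q ∈ matchingKer τ, ∃ k, e (.inl q) = .inr (q.mid, k)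
  unmatched_right : ∀ q' ∈ matchingCoker τ, ∃ k, e (.inr (q'.mid, k)) = .inl q'
  diagonal : ∀ x k y l, e (.inr (x, k)) = .inr (y, l) → y = x

/-- The contribution `2 ‖q - τ(q)‖₂²` of a point `q` to the Betti matching loss. -/
def contribution {oL : CompatibleOrdering L} {oG : CompatibleOrdering G}
    (e : Diagram oL ≃ Diagram oG) (q : Diagram oL) : ℝ :=
  2 * ‖q.point - (e q).point‖ ^ 2

/-- `x` is the Betti matching loss `l_BM(L, G) = ∑_{q ∈ Dgm(L)} 2 ‖q - τ(L, G)(q)‖₂²`, where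
`τ(L, G)` is regarded as a bijection of persistence diagrams; for binary images this is the
Betti matching error. -/
def IsBettiMatchingLoss (oL : CompatibleOrdering L) (oG : CompatibleOrdering G)
    (oC : CompatibleOrdering (comparison L G)) (x : ℝ) : Prop :=
  ∃ e : Diagram oL ≃ Diagram oG,
    IsDiagramBijection (diagramMatching oL oG oC) e ∧ HasSum (contribution e) x

end BettiMatching

end

noncomputable section

namespace BettiMatching

/-! ### The column reduction -/

section Reduction

variable {N : ℕ}

/-! The standard reduction multiplies the boundary matrix on the right by a unitriangular matrix and
leaves non-zero columns with pairwise distinct lowest entries (`reduce_spec`). Read as chains, this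
gives for each cell `d` a chain with leading cell `d` whose boundary is the reduced column of `d`.
If `(c, d)` is a pair, then `∂∂ = 0` forces the reduced column of `c` to vanish, so the chain of `c`
may be replaced by the boundary of the chain of `d`. The result is a basis `W` of all chains with
leading cells as prescribed, on which `∂` sends `W d` to `W c` for a pair `(c, d)` and to zero
otherwise (`exists_adapted_basis`). Chains, boundaries and cycles of every sublevel set are then
spanned by subfamilies of `W`, and the classes of the `W c` whose interval contains `r` form bases
of homology compatible with the transition maps (`persistentHomology_isBarcode`).

For a binary image the filter function has values 0 and 1. Hence an interval yields an off-diagonal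
point exactly when it contains 0, the point is `(0, 1)`, and the homology basis at `r = 0` counts
these points. Matched points coincide and contribute nothing. An unmatched point moves to `(1/2,
1/2)`, at squared distance 1/2, and contributes 1 because of the factor 2. Uniqueness of partners
follows from the distinct lowest entries, and the bijection of diagrams exists because infinitely
many copies of the diagonal point absorb the unmatched points. -/

theorem low_eq_coe_iff {v : Fin N → ZMod 2} {i : Fin N} :
    low v = (i : WithBot (Fin N)) ↔ v i ≠ 0 ∧ ∀ k, i < k → v k = 0 := by
  unfold low
  constructor
  · intro h
    refine ⟨(Finset.mem_filter.1 (Finset.mem_of_max h)).2, fun k hk => ?_⟩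
    by_contra hne
    have := Finset.le_max (s := Finset.univ.filter fun i => v i ≠ 0)
      (Finset.mem_filter.2 ⟨Finset.mem_univ k, hne⟩)
    rw [h] at this
    exact absurd (WithBot.coe_le_coe.1 this) (not_le.2 hk)
  · rintro ⟨h0, h⟩
    apply le_antisymm
    · refine Finset.max_le fun k hk => WithBot.coe_le_coe.2 ?_
      by_contra hlt
      exact (Finset.mem_filter.1 hk).2 (h k (not_le.1 hlt))
    · exact Finset.le_max (Finset.mem_filter.2 ⟨Finset.mem_univ i, h0⟩)

theorem low_eq_bot_iff {v : Fin N → ZMod 2} : low v = ⊥ ↔ v = 0 := by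
  simp [low, Finset.max_eq_bot, Finset.filter_eq_empty_iff, funext_iff]

theorem zmod_two_eq_one_of_ne_zero {a : ZMod 2} (h : a ≠ 0) : a = 1 := by
  revert h; revert a; decide

/-- Over `𝔽₂` both lowest entries equal 1 and cancel, while all entries of larger index are zero in
both columns. -/
theorem low_add_lt {v w : Fin N → ZMod 2} (hv : low v ≠ ⊥) (h : low w = low v) :
    low (v + w) < low v := by
  obtain ⟨i, hi⟩ := WithBot.ne_bot_iff_exists.1 hv
  rw [← hi] at h ⊢
  obtain ⟨hv0, hv1⟩ := low_eq_coe_iff.1 hi.symm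
  obtain ⟨hw0, hw1⟩ := low_eq_coe_iff.1 h
  rcases hk : low (v + w) with _ | k
  · exact WithBot.bot_lt_coe i
  · obtain ⟨hk0, -⟩ := low_eq_coe_iff.1 hk
    refine WithBot.coe_lt_coe.2 (lt_of_not_ge fun hik => hk0 ?_)
    rcases hik.eq_or_lt with rfl | hlt
    · rw [Pi.add_apply, zmod_two_eq_one_of_ne_zero hv0, zmod_two_eq_one_of_ne_zero hw0]
      decide
    · simp [hv1 k hlt, hw1 k hlt]

theorem reduceStep_cases (R : Fin N → Fin N → ZMod 2) (j : Fin N) (v : Fin N → ZMod 2) :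
    (∃ k < j, low v ≠ ⊥ ∧ low (R k) = low v ∧ reduceStep R j v = v + R k) ∨
      ((∀ k < j, low v ≠ ⊥ → low (R k) ≠ low v) ∧ reduceStep R j v = v) := by
  unfold reduceStep
  split
  · rename_i k hk
    have := List.find?_some hk
    simp only [decide_eq_true_eq] at this
    exact .inl ⟨k, this.1, this.2.1, this.2.2, rfl⟩
  · rename_i hk
    rw [List.find?_eq_none] at hk
    refine .inr ⟨fun k hkj hv hl => hk k (List.mem_finRange k) ?_, rfl⟩
    simpa using ⟨hkj, hv, hl⟩

/-- Guarantees that the fixed number of `N` iterations in `reduce` really ends at a column to which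
no step applies. -/
theorem iterate_fixed_of_measure {α : Type*} (f : α → α) (μ : α → ℕ)
    (h : ∀ v, f v = v ∨ μ (f v) < μ v) (n : ℕ) (v : α) (hv : μ v ≤ n) :
    f (f^[n] v) = f^[n] v := by
  induction n generalizing v with
  | zero =>
    rcases h v with h | h
    · exact h
    · omega
  | succ n ih =>
    rw [Function.iterate_succ_apply]
    rcases h v with h' | h'
    · rw [h', Function.iterate_fixed h', h']
    · exact ih _ (by omega)

/-- The number of the lowest non-zero entry, counted from `1`, and `0` for the zero column. -/
def lowIndex (v : Fin N → ZMod 2) : ℕ := (low v).recBotCoe 0 fun i => (i : ℕ) + 1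

theorem lowIndex_le (v : Fin N → ZMod 2) : lowIndex v ≤ N := by
  unfold lowIndex
  induction low v using WithBot.recBotCoe with
  | bot => exact Nat.zero_le _
  | coe i => exact i.2

theorem lowIndex_lt {v w : Fin N → ZMod 2} (h : low w < low v) : lowIndex w < lowIndex v := by
  unfold lowIndex
  revert h
  induction low v using WithBot.recBotCoe with
  | bot => exact fun h => absurd h not_lt_bot
  | coe i =>
    induction low w using WithBot.recBotCoe with
    | bot => exact fun _ => Nat.succ_pos _
    | coe k => exact fun h => Nat.succ_lt_succ (Fin.lt_def.1 (WithBot.coe_lt_coe.1 h))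

theorem reduceStep_iterate_low (R : Fin N → Fin N → ZMod 2) (j : Fin N) (v : Fin N → ZMod 2)
    (k : Fin N) (hk : k < j) (h : low ((reduceStep R j)^[N] v) ≠ ⊥) :
    low (R k) ≠ low ((reduceStep R j)^[N] v) := by
  have hfix := iterate_fixed_of_measure (reduceStep R j) lowIndex (fun v => by
    rcases reduceStep_cases R j v with ⟨k, -, hv, hl, he⟩ | ⟨-, he⟩
    · exact .inr (he ▸ lowIndex_lt (low_add_lt hv hl))
    · exact .inl he) N v (lowIndex_le v)
  rcases reduceStep_cases R j ((reduceStep R j)^[N] v) with ⟨k', -, hv, hl, he⟩ | ⟨h', -⟩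
  -- A step that applied at a fixed point would add a zero column, but the added column has a lowest
  -- entry.
  · rw [hfix] at he
    have h0 : R k' = 0 := by simpa using he.symm
    exact absurd (low_eq_bot_iff.2 h0) (hl ▸ hv)
  · exact h' k hk h

theorem reduceStep_iterate_mem (R : Fin N → Fin N → ZMod 2) (j : Fin N)
    (U : Submodule (ZMod 2) (Fin N → ZMod 2)) (hR : ∀ k < j, R k ∈ U) (v : Fin N → ZMod 2)
    (n : ℕ) : (reduceStep R j)^[n] v - v ∈ U := by
  induction n generalizing v with
  | zero => simp
  | succ n ih =>
    rw [Function.iterate_succ_apply]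
    have h1 := ih (reduceStep R j v)
    have h2 : reduceStep R j v - v ∈ U := by
      rcases reduceStep_cases R j v with ⟨k, hk, -, -, he⟩ | ⟨-, he⟩
      · rw [he, add_sub_cancel_left]; exact hR k hk
      · rw [he, sub_self]; exact U.zero_mem
    simpa using U.add_mem h1 h2

/-- Loop invariant of the fold after `t` columns. The span is taken over the original columns, so
that the accumulated column operations form a unitriangular matrix. -/
theorem reduce_take_spec (B : Fin N → Fin N → ZMod 2) (t : ℕ) (ht : t ≤ N) :
    ∃ R : Fin N → Fin N → ZMod 2,
      ((List.finRange N).take t).foldl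
        (fun R j => Function.update R j ((reduceStep R j)^[N] (R j))) B = R ∧
      (∀ j : Fin N, t ≤ j → R j = B j) ∧
      (∀ j : Fin N, (j : ℕ) < t → R j - B j ∈ Submodule.span (ZMod 2) (B '' Set.Iio j)) ∧
      (∀ j k : Fin N, k < j → (j : ℕ) < t → low (R j) ≠ ⊥ → low (R k) ≠ low (R j)) := by
  induction t with
  | zero => exact ⟨B, by simp⟩
  | succ t ih =>
    obtain ⟨R, hR, h1, h2, h3⟩ := ih (by omega)
    let j₀ : Fin N := ⟨t, ht⟩
    have htake : (List.finRange N).take (t + 1) = (List.finRange N).take t ++ [j₀] := by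
      rw [List.take_succ_eq_append_getElem (by simpa using ht)]
      simp [j₀]
    refine ⟨Function.update R j₀ ((reduceStep R j₀)^[N] (R j₀)),
      by rw [htake, List.foldl_append, hR]; rfl, ?_, ?_, ?_⟩
    · intro j hj
      have : j ≠ j₀ := by rintro rfl; simp [j₀] at hj
      rw [Function.update_of_ne this]
      exact h1 j (by omega)
    · intro j hj
      rcases eq_or_ne j j₀ with rfl | hne
      · rw [Function.update_self, h1 j₀ le_rfl]
        refine reduceStep_iterate_mem R j₀ _ (fun k hk => ?_) _ N
        have hB : B k ∈ Submodule.span (ZMod 2) (B '' Set.Iio j₀) :=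
          Submodule.subset_span ⟨k, hk, rfl⟩
        have := Submodule.span_mono (Set.image_mono (Set.Iio_subset_Iio hk.le)) (h2 k hk)
        simpa using Submodule.add_mem _ this hB
      · rw [Function.update_of_ne hne]
        exact h2 j (lt_of_le_of_ne (by omega) fun h => hne (Fin.ext h))
    · intro j k hkj hj
      have hk : k ≠ j₀ := by
        rintro rfl
        have : t < (j : ℕ) := hkj
        omega
      rw [Function.update_of_ne hk]
      rcases eq_or_ne j j₀ with rfl | hne
      · rw [Function.update_self]
        exact reduceStep_iterate_low R j₀ _ k hkj
      · rw [Function.update_of_ne hne]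
        exact h3 j k hkj (lt_of_le_of_ne (by omega) fun h => hne (Fin.ext h))

/-- The only two properties of the algorithm that are used later: the operations are unitriangular,
and lowest entries of non-zero columns are distinct. -/
theorem reduce_spec (B : Fin N → Fin N → ZMod 2) :
    (∀ j, reduce B j - B j ∈ Submodule.span (ZMod 2) (B '' Set.Iio j)) ∧
      ∀ j k, low (reduce B j) ≠ ⊥ → low (reduce B k) = low (reduce B j) → k = j := by
  obtain ⟨R, hR, -, h2, h3⟩ := reduce_take_spec B N le_rfl
  rw [List.take_of_length_le (by simp)] at hR
  change reduce B = R at hR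
  subst hR
  refine ⟨fun j => h2 j j.2, fun j k hj h => ?_⟩
  rcases lt_trichotomy k j with hlt | rfl | hlt
  · exact absurd h (h3 j k hlt j.2 hj)
  · rfl
  · exact absurd h.symm (h3 k j hlt k.2 (h ▸ hj))

end Reduction

variable {m n : ℕ} {I J L G : Matrix (Fin m) (Fin n) ℝ}

/-! ### The boundary map squares to zero -/

/-- The dimension of an elementary interval. -/
def GridInterval.dim (s : GridInterval m) : ℕ := if s.1.1 = s.1.2 then 0 else 1

theorem GridInterval.Sub.dim_le {s t : GridInterval m} (h : s.Sub t) : s.dim ≤ t.dim := by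
  have hs := s.2
  have ht := t.2
  simp only [GridInterval.Sub, GridInterval.dim, Fin.le_def, Fin.ext_iff] at *
  split_ifs <;> omega

theorem GridInterval.Sub.eq_of_dim_eq {s t : GridInterval m} (h : s.Sub t)
    (hd : s.dim = t.dim) : s = t := by
  have hs := s.2
  have ht := t.2
  simp only [GridInterval.Sub, GridInterval.dim, Fin.le_def, Fin.ext_iff, Subtype.ext_iff,
    Prod.ext_iff] at *
  split_ifs at hd <;> omega

theorem GridInterval.dim_le_one (s : GridInterval m) : s.dim ≤ 1 := by
  unfold GridInterval.dim; split_ifs <;> simp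

theorem GridInterval.Sub.refl (s : GridInterval m) : s.Sub s := ⟨le_rfl, le_rfl⟩

theorem Cell.isFacet_iff (c d : Cell m n) :
    c.IsFacet d ↔ ((c.1.Sub d.1 ∧ d.1.dim = c.1.dim + 1) ∧ c.2 = d.2) ∨
      (c.1 = d.1 ∧ (c.2.Sub d.2 ∧ d.2.dim = c.2.dim + 1)) := by
  have hdim : ∀ c : Cell m n, c.dim = c.1.dim + c.2.dim := fun _ => rfl
  unfold Cell.IsFacet Cell.IsFace
  rw [hdim, hdim]
  constructor
  · rintro ⟨⟨h1, h2⟩, h⟩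
    have h1' := h1.dim_le
    have h2' := h2.dim_le
    rcases h1'.eq_or_lt with he | hlt
    · exact .inr ⟨h1.eq_of_dim_eq he, h2, by omega⟩
    · have : c.2.dim = d.2.dim := by
        have := d.1.dim_le_one
        omega
      exact .inl ⟨⟨h1, by omega⟩, h2.eq_of_dim_eq this⟩
  · rintro (⟨⟨h1, h2⟩, h⟩ | ⟨h, h1, h2⟩)
    · exact ⟨⟨h1, h ▸ GridInterval.Sub.refl _⟩, by rw [h]; omega⟩
    · exact ⟨⟨h ▸ GridInterval.Sub.refl _, h1⟩, by rw [h]; omega⟩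

open Classical in
/-- The boundary matrix of the one-dimensional grid complex. -/
def intervalBoundary (m : ℕ) : Matrix (GridInterval m) (GridInterval m) (ZMod 2) :=
  Matrix.of fun s t => if s.Sub t ∧ t.dim = s.dim + 1 then 1 else 0

/-- A non-zero product would raise the dimension twice, but intervals have dimension at most one. -/
theorem intervalBoundary_mul_self (m : ℕ) : intervalBoundary m * intervalBoundary m = 0 := by
  ext s t
  rw [Matrix.mul_apply]
  refine Finset.sum_eq_zero fun u _ => ?_
  simp only [intervalBoundary, Matrix.of_apply]
  have := t.dim_le_one
  split_ifs with h1 h2 <;> first | omega | simp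

open scoped Kronecker in
-- A facet of a product shrinks exactly one factor, and no signs occur in characteristic two.
theorem boundary_eq_kronecker :
    (Matrix.of fun c d : Cell m n => if c.IsFacet d then (1 : ZMod 2) else 0) =
      intervalBoundary m ⊗ₖ (1 : Matrix (GridInterval n) (GridInterval n) (ZMod 2)) +
        (1 : Matrix (GridInterval m) (GridInterval m) (ZMod 2)) ⊗ₖ intervalBoundary n := by
  ext c d
  simp only [Matrix.of_apply, Matrix.add_apply, Matrix.kroneckerMap_apply, intervalBoundary,
    Matrix.one_apply]
  classical
  rw [if_congr (Cell.isFacet_iff c d) rfl rfl]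
  by_cases h1 : c.1 = d.1 <;> by_cases h2 : c.2 = d.2 <;> simp [h1, h2]

theorem boundary_boundary (x : Chain m n) : boundary m n (boundary m n x) = 0 := by
  unfold boundary
  rw [← Matrix.toLin'_mul_apply, boundary_eq_kronecker, Matrix.add_mul, Matrix.mul_add,
    Matrix.mul_add]
  simp only [← Matrix.mul_kronecker_mul, intervalBoundary_mul_self, Matrix.one_mul,
    Matrix.mul_one, Matrix.zero_kronecker, Matrix.kronecker_zero, zero_add, add_zero]
  -- The two mixed terms are the same Kronecker product and cancel modulo 2.
  rw [← two_smul (ZMod 2), show (2 : ZMod 2) = 0 from rfl, zero_smul, map_zero,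
    LinearMap.zero_apply]

/-! ### Leading cells -/

/-- `c` is the last cell with a non-zero coefficient in `x`. -/
def IsLead (o : CompatibleOrdering I) (x : Chain m n) (c : Cell m n) : Prop :=
  x c ≠ 0 ∧ ∀ c', o.pos c < o.pos c' → x c' = 0

/-- In a non-trivial relation, the largest leading cell that occurs gets a contribution from one
term only. -/
theorem linearIndependent_of_isLead (o : CompatibleOrdering I) {κ : Type*} (u : κ → Chain m n)
    (l : κ → Cell m n) (hl : Function.Injective l) (h : ∀ k, IsLead o (u k) (l k)) :
    LinearIndependent (ZMod 2) u := by
  classical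
  rw [linearIndependent_iff']
  intro s g hg
  by_contra! hne
  obtain ⟨k₀, hk₀, hgk₀⟩ := hne
  obtain ⟨k, hk, hmax⟩ := (s.filter fun k => g k ≠ 0).exists_max_image (fun k => o.pos (l k))
    ⟨k₀, Finset.mem_filter.2 ⟨hk₀, hgk₀⟩⟩
  rw [Finset.mem_filter] at hk
  have h0 := congrFun hg (l k)
  rw [Finset.sum_apply, Finset.sum_eq_single_of_mem k hk.1] at h0
  · exact mul_ne_zero hk.2 (h k).1 h0
  · intro k' hk' hkk'
    by_cases hgk' : g k' = 0
    · simp [hgk']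
    · have hle := hmax k' (Finset.mem_filter.2 ⟨hk', hgk'⟩)
      have hlt : o.pos (l k') < o.pos (l k) :=
        lt_of_le_of_ne hle fun he => hkk' (hl (o.pos.injective he))
      simp [(h k').2 _ hlt]

theorem mem_span_single {S : Set (Cell m n)} {x : Chain m n} (hx : x ∈ chains S) :
    x ∈ Submodule.span (ZMod 2) ((fun c => Pi.single c (1 : ZMod 2)) '' S) := by
  classical
  have : x = ∑ c, x c • (Pi.single c (1 : ZMod 2) : Chain m n) := by
    ext c'
    simp [Finset.sum_apply, Pi.single_apply]
  rw [this]
  refine Submodule.sum_mem _ fun c _ => ?_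
  by_cases hc : c ∈ S
  · exact Submodule.smul_mem _ _ (Submodule.subset_span ⟨c, hc, rfl⟩)
  · simp [hx c hc]

/-- Triangular elimination: subtracting the unit chain at `c` from `u c` leaves only earlier cells,
so induction on the position applies. An initial segment `S` contains all the cells needed. -/
theorem chains_le_span_of_isLead (o : CompatibleOrdering I) (u : Cell m n → Chain m n)
    (hu : ∀ c, IsLead o (u c) c) {S : Set (Cell m n)}
    (hS : ∀ c d, d ∈ S → o.pos c ≤ o.pos d → c ∈ S) :
    chains S ≤ Submodule.span (ZMod 2) (u '' S) := by
  classical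
  have key : ∀ p c, o.pos c = p → (Pi.single c (1 : ZMod 2) : Chain m n) ∈
      Submodule.span (ZMod 2) (u '' {c' | o.pos c' ≤ o.pos c}) := by
    intro p
    induction p using WellFoundedLT.induction with
    | ind p ih =>
      rintro c rfl
      have h1 : u c ∈ Submodule.span (ZMod 2) (u '' {c' | o.pos c' ≤ o.pos c}) :=
        Submodule.subset_span (Set.mem_image_of_mem u (Set.mem_ofPred.2 le_rfl))
      have h2 : u c - Pi.single c 1 ∈ chains {c' | o.pos c' < o.pos c} := by
        intro c' hc'
        rcases eq_or_ne c' c with rfl | hne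
        · simp [zmod_two_eq_one_of_ne_zero (hu c').1]
        · have : o.pos c < o.pos c' :=
            lt_of_le_of_ne (not_lt.1 hc') fun he => hne (o.pos.injective he).symm
          simp [(hu c).2 c' this, Pi.single_eq_of_ne hne]
      have h3 : u c - Pi.single c 1 ∈
          Submodule.span (ZMod 2) (u '' {c' | o.pos c' ≤ o.pos c}) := by
        refine Submodule.span_le.2 ?_ (mem_span_single h2)
        rintro _ ⟨c', hc', rfl⟩
        have hlt : o.pos c' < o.pos c := hc'
        have hsub : {a | o.pos a ≤ o.pos c'} ⊆ {a | o.pos a ≤ o.pos c} :=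
          fun a (ha : o.pos a ≤ o.pos c') => ha.trans hlt.le
        exact Submodule.span_mono (Set.image_mono hsub) (ih (o.pos c') hlt c' rfl)
      simpa using Submodule.sub_mem _ h1 h3
  intro x hx
  refine Submodule.span_le.2 ?_ (mem_span_single hx)
  rintro _ ⟨c, hc, rfl⟩
  have hsub : {a | o.pos a ≤ o.pos c} ⊆ S := fun a ha => hS a c hc ha
  exact Submodule.span_mono (Set.image_mono hsub) (key (o.pos c) c rfl)

/-! ### The reduced columns as chains -/

theorem isPair_right_unique (o : CompatibleOrdering I) (o' : CompatibleOrdering J)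
    {c d d' : Cell m n} (h : IsPair o o' c d) (h' : IsPair o o' c d') : d = d' := by
  unfold IsPair at h h'
  refine o'.pos.injective ((reduce_spec _).2 _ _ ?_ (h.trans h'.symm))
  rw [h']
  exact WithBot.coe_ne_bot

theorem isPair_left_unique (o : CompatibleOrdering I) (o' : CompatibleOrdering J)
    {c c' d : Cell m n} (h : IsPair o o' c d) (h' : IsPair o o' c' d) : c = c' :=
  o.pos.injective (WithBot.coe_injective (h.symm.trans h'))

/-- Chains as columns, with rows ordered by `o`. -/
def toColumn (o : CompatibleOrdering I) :
    Chain m n ≃ₗ[ZMod 2] (Fin (Fintype.card (Cell m n)) → ZMod 2) :=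
  LinearEquiv.funCongrLeft (ZMod 2) (ZMod 2) o.pos.symm

theorem low_toColumn_iff (o : CompatibleOrdering I) (x : Chain m n) (c : Cell m n) :
    low (toColumn o x) = (o.pos c : WithBot _) ↔ IsLead o x c := by
  rw [low_eq_coe_iff]
  simp only [toColumn, LinearEquiv.funCongrLeft_apply, LinearMap.funLeft_apply,
    Equiv.symm_apply_apply, IsLead]
  refine and_congr_right fun _ => ⟨fun h c' hc' => ?_, fun h k hk => h _ (by simpa using hk)⟩
  simpa using h (o.pos c') hc'

theorem boundaryMatrix_pos (o : CompatibleOrdering I) (d : Cell m n) :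
    boundaryMatrix o o (o.pos d) = toColumn o (boundary m n (Pi.single d 1)) := by
  ext i
  simp [boundaryMatrix, toColumn, boundary, LinearMap.funLeft_apply]

/-- Records the column operations on chains: adding earlier columns to that of `d` means taking the
boundary of `d` plus a combination of earlier cells. -/
theorem exists_reduced_chain (o : CompatibleOrdering I) (d : Cell m n) :
    ∃ v : Chain m n, IsLead o v d ∧
      toColumn o (boundary m n v) = reduce (boundaryMatrix o o) (o.pos d) := by
  classical
  have h := (reduce_spec (boundaryMatrix o o)).1 (o.pos d)
  have himg : boundaryMatrix o o '' Set.Iio (o.pos d) =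
      ((toColumn o).toLinearMap ∘ₗ boundary m n) ''
        ((fun c => Pi.single c (1 : ZMod 2)) '' {c | o.pos c < o.pos d}) := by
    ext y
    constructor
    · rintro ⟨k, hk, rfl⟩
      refine ⟨_, ⟨o.pos.symm k, by simpa using hk, rfl⟩, ?_⟩
      simpa using (boundaryMatrix_pos o (o.pos.symm k)).symm
    · rintro ⟨_, ⟨c, hc, rfl⟩, rfl⟩
      exact ⟨o.pos c, hc, boundaryMatrix_pos o c⟩
  rw [himg, Submodule.span_image] at h
  obtain ⟨w, hw, he⟩ := h
  have hw' : ∀ c, o.pos d ≤ o.pos c → w c = 0 := by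
    have : Submodule.span (ZMod 2) ((fun c => Pi.single c (1 : ZMod 2)) ''
        {c | o.pos c < o.pos d}) ≤ chains {c | o.pos c < o.pos d} := by
      rw [Submodule.span_le]
      rintro _ ⟨c, hc, rfl⟩ c' hc'
      have hne : c' ≠ c := by rintro rfl; exact hc' hc
      exact Pi.single_eq_of_ne hne _
    exact fun c hc => this hw c (not_lt.2 hc)
  refine ⟨Pi.single d 1 + w, ⟨?_, fun c hc => ?_⟩, ?_⟩
  · simp [hw' d le_rfl]
  · have : c ≠ d := by rintro rfl; exact lt_irrefl _ hc
    simp [hw' c hc.le, Pi.single_eq_of_ne this]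
  · rw [map_add, map_add, ← boundaryMatrix_pos]
    rw [LinearMap.comp_apply] at he
    rw [LinearEquiv.coe_coe] at he
    rw [he]; abel

/-- A basis of the chains that is adapted to the filtration and to the boundary map. -/
theorem exists_adapted_basis (o : CompatibleOrdering I) :
    ∃ W : Module.Basis (Cell m n) (ZMod 2) (Chain m n), (∀ c, IsLead o (W c) c) ∧
      (∀ c d, IsPair o o c d → boundary m n (W d) = W c) ∧
      (∀ d, (∀ c, ¬ IsPair o o c d) → boundary m n (W d) = 0) := by
  classical
  choose v hv hcol using exists_reduced_chain o
  have hpair : ∀ c d, IsPair o o c d ↔ IsLead o (boundary m n (v d)) c := fun c d => by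
    rw [← low_toColumn_iff, hcol]; rfl
  have hzero : ∀ d, (∀ c, ¬ IsPair o o c d) → boundary m n (v d) = 0 := by
    intro d hd
    rw [← (toColumn o).map_eq_zero_iff, hcol, ← low_eq_bot_iff]
    by_contra hne
    obtain ⟨i, hi⟩ := WithBot.ne_bot_iff_exists.1 hne
    exact hd (o.pos.symm i) (by unfold IsPair; rw [← hi, Equiv.apply_symm_apply])
  -- A row that contains a lowest entry belongs to a zero column.
  have hbirth : ∀ c d, IsPair o o c d → boundary m n (v c) = 0 := by
    intro c d hcd
    by_contra hne
    have hlead := (hpair c d).1 hcd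
    -- Both chains have leading cell `c` with coefficient 1, so only earlier cells survive in the
    -- difference.
    have hmem : boundary m n (v d) - v c ∈ chains {c' | o.pos c' < o.pos c} := by
      intro c' hc'
      rcases eq_or_ne c' c with rfl | hcc
      · simp [zmod_two_eq_one_of_ne_zero (hv c').1, zmod_two_eq_one_of_ne_zero hlead.1]
      · have : o.pos c < o.pos c' :=
          lt_of_le_of_ne (not_lt.1 hc') fun he => hcc (o.pos.injective he).symm
        simp [(hv c).2 c' this, hlead.2 c' this]
    have hspan := chains_le_span_of_isLead o v hv
      (fun a b hb hab => lt_of_le_of_lt hab hb) hmem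
    -- Applying `∂` and using `∂∂ = 0` puts `∂ (v c)` into the span of the `∂ (v k)` with `k` before
    -- `c`. This contradicts the independence of the non-zero reduced columns.
    have him := Submodule.mem_map_of_mem (f := boundary m n) hspan
    rw [map_sub, boundary_boundary, zero_sub, Submodule.neg_mem_iff, ← Submodule.span_image]
      at him
    let κ := {k : Cell m n // boundary m n (v k) ≠ 0}
    have hex : ∀ k : κ, ∃ l, IsPair o o l k.1 := fun k => by
      by_contra! h
      exact k.2 (hzero _ h)
    choose l hl using hex
    have hlin : LinearIndependent (ZMod 2) fun k : κ => boundary m n (v k.1) :=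
      linearIndependent_of_isLead o _ l
        (fun k k' he => Subtype.ext (isPair_right_unique o o (hl k) (he ▸ hl k')))
        fun k => (hpair _ _).1 (hl k)
    refine hlin.notMem_span_image (s := {k : κ | o.pos k.1 < o.pos c}) (x := ⟨c, hne⟩)
      (fun h => lt_irrefl (o.pos c) h) (Submodule.span_le.2 ?_ him)
    rintro _ ⟨_, ⟨k, hk, rfl⟩, rfl⟩
    by_cases h0 : boundary m n (v k) = 0
    · rw [h0]; exact Submodule.zero_mem _
    · exact Submodule.subset_span ⟨⟨k, h0⟩, hk, rfl⟩
  -- The replacement keeps the leading cell by the definition of a pair, and it keeps the boundary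
  -- because both boundaries vanish (`hbirth`).
  let w : Cell m n → Chain m n := fun c =>
    if h : ∃ d, IsPair o o c d then boundary m n (v h.choose) else v c
  have hw1 : ∀ c d, IsPair o o c d → w c = boundary m n (v d) := by
    intro c d h
    have hex : ∃ d, IsPair o o c d := ⟨d, h⟩
    simp only [w, dif_pos hex, isPair_right_unique o o hex.choose_spec h]
  have hw2 : ∀ c, (¬ ∃ d, IsPair o o c d) → w c = v c := fun c h => by simp only [w, dif_neg h]
  have hw : ∀ c, IsLead o (w c) c := by
    intro c
    by_cases h : ∃ d, IsPair o o c d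
    · obtain ⟨d, hd⟩ := h
      rw [hw1 c d hd]; exact (hpair c d).1 hd
    · rw [hw2 c h]; exact hv c
  have hbw : ∀ c, boundary m n (w c) = boundary m n (v c) := by
    intro c
    by_cases h : ∃ d, IsPair o o c d
    · obtain ⟨d, hd⟩ := h
      rw [hw1 c d hd, boundary_boundary, hbirth c d hd]
    · rw [hw2 c h]
  have hlin := linearIndependent_of_isLead o w id Function.injective_id hw
  refine ⟨Module.Basis.mk hlin ?_, fun c => ?_, fun c d h => ?_, fun d h => ?_⟩
  · rw [← Set.image_univ]
    exact fun x _ => chains_le_span_of_isLead o w hw (fun _ _ _ _ => Set.mem_univ _)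
      (fun c hc => absurd (Set.mem_univ c) hc)
  · rw [Module.Basis.mk_apply]; exact hw c
  · rw [Module.Basis.mk_apply, Module.Basis.mk_apply, hbw, hw1 c d h]
  · rw [Module.Basis.mk_apply, hbw, hzero d h]

/-! ### The barcode of persistent homology -/

theorem sublevel_lower (o : CompatibleOrdering I) (r : ℝ) (c d : Cell m n)
    (hd : d ∈ sublevel I r) (h : o.pos c ≤ o.pos d) : c ∈ sublevel I r := by
  by_contra hc
  have : filterFunction I d < filterFunction I c := lt_of_le_of_lt hd (not_le.1 hc)
  exact absurd (o.pos_lt_of_lt _ _ this) (not_lt.2 h)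

/-- The cell that gives birth to an interval of the barcode. -/
def Barcode.birth {o : CompatibleOrdering I} : Barcode o → Cell m n
  | .inl p => p.1.1
  | .inr c => c.1

theorem Barcode.birth_injective {o : CompatibleOrdering I} :
    Function.Injective (Barcode.birth (o := o)) := by
  rintro (⟨⟨c, d⟩, hp⟩ | ⟨c, hc⟩) (⟨⟨c', d'⟩, hq⟩ | ⟨c', hc'⟩) h
  · obtain rfl : c = c' := h
    obtain rfl : d = d' := isPair_right_unique o o hp.1 hq.1
    rfl
  · obtain rfl : c = c' := h
    exact absurd hp.1 (hc' d).1
  · obtain rfl : c = c' := h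
    exact absurd hq.1 (hc d').1
  · obtain rfl : c = c' := h
    rfl

theorem Barcode.birth_mem {o : CompatibleOrdering I} (i : Barcode o) {r : ℝ}
    (h : r ∈ i.interval) : i.birth ∈ sublevel I r := by
  rcases i with p | c
  · exact h.1
  · exact h

theorem Barcode.interval_nonempty {o : CompatibleOrdering I} (i : Barcode o) :
    i.interval.Nonempty := by
  rcases i with p | c
  · exact Set.nonempty_Ico.2 p.2.2
  · exact Set.nonempty_Ici

theorem Barcode.interval_ordConnected {o : CompatibleOrdering I} (i : Barcode o) :
    i.interval.OrdConnected := by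
  rcases i with p | c
  · exact Set.ordConnected_Ico
  · exact Set.ordConnected_Ici

/-! ### Cycles, boundaries and homology of sublevel sets in an adapted basis. -/

section AdaptedBasis

variable {o : CompatibleOrdering I} {W : Module.Basis (Cell m n) (ZMod 2) (Chain m n)}

theorem chains_sublevel_eq_span (hW : ∀ c, IsLead o (W c) c) (r : ℝ) :
    chains (sublevel I r) = Submodule.span (ZMod 2) (W '' sublevel I r) := by
  refine le_antisymm (chains_le_span_of_isLead o W hW (sublevel_lower o r)) ?_
  rw [Submodule.span_le]
  rintro _ ⟨c, hc, rfl⟩ c' hc'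
  refine (hW c).2 c' (not_le.1 fun h => hc' (sublevel_lower o r _ _ hc h))

theorem boundary_birth_eq_zero (h1 : ∀ c d, IsPair o o c d → boundary m n (W d) = W c)
    (h0 : ∀ d, (∀ c, ¬ IsPair o o c d) → boundary m n (W d) = 0) (i : Barcode o) :
    boundary m n (W i.birth) = 0 := by
  rcases i with p | c
  · change boundary m n (W p.1.1) = 0
    rw [← h1 _ _ p.2.1, boundary_boundary]
  · exact h0 _ fun d => (c.2 d).2

theorem boundaries_sublevel_eq_span (hW : ∀ c, IsLead o (W c) c)
    (h1 : ∀ c d, IsPair o o c d → boundary m n (W d) = W c)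
    (h0 : ∀ d, (∀ c, ¬ IsPair o o c d) → boundary m n (W d) = 0) (r : ℝ) :
    boundaries (sublevel I r) =
      Submodule.span (ZMod 2) (W '' {c | ∃ d ∈ sublevel I r, IsPair o o c d}) := by
  unfold boundaries
  rw [chains_sublevel_eq_span hW, ← Submodule.span_image]
  apply le_antisymm <;> rw [Submodule.span_le]
  · rintro _ ⟨_, ⟨d, hd, rfl⟩, rfl⟩
    by_cases h : ∃ c, IsPair o o c d
    · obtain ⟨c, hc⟩ := h
      rw [h1 c d hc]
      exact Submodule.subset_span ⟨c, ⟨d, hd, hc⟩, rfl⟩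
    · rw [h0 d (not_exists.1 h)]
      exact Submodule.zero_mem _
  · rintro _ ⟨c, ⟨d, hd, hc⟩, rfl⟩
    exact Submodule.subset_span ⟨W d, ⟨d, hd, rfl⟩, h1 c d hc⟩

/-- Among the basis vectors only `W d` has boundary `W c`, since partners are unique. -/
theorem repr_boundary (h1 : ∀ c d, IsPair o o c d → boundary m n (W d) = W c)
    (h0 : ∀ d, (∀ c, ¬ IsPair o o c d) → boundary m n (W d) = 0) {c d : Cell m n}
    (h : IsPair o o c d) (x : Chain m n) : W.repr (boundary m n x) c = W.repr x d := by
  classical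
  have : W.coord c ∘ₗ boundary m n = W.coord d := by
    refine W.ext fun d' => ?_
    rw [LinearMap.comp_apply, Module.Basis.coord_apply, Module.Basis.coord_apply,
      Module.Basis.repr_self]
    by_cases hd' : ∃ c', IsPair o o c' d'
    · obtain ⟨c', hc'⟩ := hd'
      rw [h1 c' d' hc', Module.Basis.repr_self]
      rcases eq_or_ne d' d with rfl | hne
      · rw [isPair_left_unique o o h hc']; simp
      · have : c' ≠ c := by rintro rfl; exact hne (isPair_right_unique o o hc' h)
        rw [Finsupp.single_eq_of_ne this.symm, Finsupp.single_eq_of_ne hne.symm]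
    · have : d' ≠ d := by rintro rfl; exact hd' ⟨c, h⟩
      rw [h0 d' (not_exists.1 hd'), map_zero, Finsupp.single_eq_of_ne this.symm,
        Finsupp.zero_apply]
  exact LinearMap.congr_fun this x

theorem cycles_sublevel_le (hW : ∀ c, IsLead o (W c) c)
    (h1 : ∀ c d, IsPair o o c d → boundary m n (W d) = W c)
    (h0 : ∀ d, (∀ c, ¬ IsPair o o c d) → boundary m n (W d) = 0) (r : ℝ) :
    cycles (sublevel I r) ≤
      Submodule.span (ZMod 2) (W '' (Barcode.birth '' {i : Barcode o | r ∈ i.interval})) ⊔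
        boundaries (sublevel I r) := by
  rw [boundaries_sublevel_eq_span hW h1 h0, ← Submodule.span_union, ← Set.image_union]
  intro x hx
  have hx1 : x ∈ chains (sublevel I r) := hx.1
  have hx2 : boundary m n x = 0 := hx.2
  rw [chains_sublevel_eq_span hW, Module.Basis.mem_span_image] at hx1
  rw [Module.Basis.mem_span_image]
  intro c hc
  have hcr : filterFunction I c ≤ r := hx1 hc
  -- A cycle has zero coordinate at every cell that kills a class, since that coordinate is one of
  -- its boundary. The remaining cells are killed by `r`, alive at `r`, or essential.
  have hdeath : ∀ d, ¬ IsPair o o d c := fun d hd => by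
    have := repr_boundary h1 h0 hd x
    rw [hx2, map_zero] at this
    exact Finsupp.mem_support_iff.1 hc this.symm
  by_cases hb : ∃ d, IsPair o o c d
  · obtain ⟨d, hd⟩ := hb
    by_cases hdr : filterFunction I d ≤ r
    · exact .inr ⟨d, hdr, hd⟩
    · have hdr := not_le.1 hdr
      exact .inl ⟨.inl ⟨(c, d), hd, lt_of_le_of_lt hcr hdr⟩, ⟨hcr, hdr⟩, rfl⟩
  · exact .inl ⟨.inr ⟨c, fun d => ⟨not_exists.1 hb d, hdeath d⟩⟩, hcr, rfl⟩

/-- The spans belong to disjoint parts of a basis: an interval containing `r` is not yet killed at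
`r`. -/
theorem disjoint_birth_boundaries (hW : ∀ c, IsLead o (W c) c)
    (h1 : ∀ c d, IsPair o o c d → boundary m n (W d) = W c)
    (h0 : ∀ d, (∀ c, ¬ IsPair o o c d) → boundary m n (W d) = 0) (r : ℝ) :
    Disjoint (Submodule.span (ZMod 2) (W '' (Barcode.birth '' {i : Barcode o | r ∈ i.interval})))
      (boundaries (sublevel I r)) := by
  rw [boundaries_sublevel_eq_span hW h1 h0]
  refine W.linearIndependent.disjoint_span_image (Set.disjoint_left.2 ?_)
  rintro _ ⟨i, hi, rfl⟩ ⟨d, hd, hp⟩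
  rcases i with p | c
  · obtain rfl : p.1.2 = d := isPair_right_unique o o p.2.1 hp
    exact absurd hi.2 (not_lt.2 hd)
  · exact (c.2 d).1 hp

/-- The cycle that represents an interval of the barcode. -/
def barcodeCycle (hW : ∀ c, IsLead o (W c) c)
    (h1 : ∀ c d, IsPair o o c d → boundary m n (W d) = W c)
    (h0 : ∀ d, (∀ c, ¬ IsPair o o c d) → boundary m n (W d) = 0) (r : ℝ)
    (i : {i : Barcode o // r ∈ i.interval}) : cycles (sublevel I r) :=
  ⟨W i.1.birth, by
    rw [chains_sublevel_eq_span hW]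
    exact Submodule.subset_span ⟨_, i.1.birth_mem i.2, rfl⟩,
    boundary_birth_eq_zero h1 h0 i.1⟩

theorem map_span_barcodeCycle (hW : ∀ c, IsLead o (W c) c)
    (h1 : ∀ c d, IsPair o o c d → boundary m n (W d) = W c)
    (h0 : ∀ d, (∀ c, ¬ IsPair o o c d) → boundary m n (W d) = 0) (r : ℝ) :
    (Submodule.span (ZMod 2) (Set.range (barcodeCycle hW h1 h0 r))).map
        (cycles (sublevel I r)).subtype =
      Submodule.span (ZMod 2) (W '' (Barcode.birth '' {i : Barcode o | r ∈ i.interval})) := by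
  rw [← Submodule.span_image]
  congr 1
  ext x
  constructor
  · rintro ⟨_, ⟨i, rfl⟩, rfl⟩
    exact ⟨_, ⟨i.1, i.2, rfl⟩, rfl⟩
  · rintro ⟨_, ⟨i, hi, rfl⟩, rfl⟩
    exact ⟨_, ⟨⟨i, hi⟩, rfl⟩, rfl⟩

/-- The homology classes of the intervals of the barcode that contain `r`. -/
def barcodeBasis (hW : ∀ c, IsLead o (W c) c)
    (h1 : ∀ c d, IsPair o o c d → boundary m n (W d) = W c)
    (h0 : ∀ d, (∀ c, ¬ IsPair o o c d) → boundary m n (W d) = 0) (r : ℝ) :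
    Module.Basis {i : Barcode o // r ∈ i.interval} (ZMod 2) (Homology (sublevel I r)) :=
  Module.Basis.mk
    (v := fun i => ((boundaries (sublevel I r)).submoduleOf (cycles (sublevel I r))).mkQ
      (barcodeCycle hW h1 h0 r i))
    (by
      have hlin : LinearIndependent (ZMod 2) (barcodeCycle hW h1 h0 r) := by
        refine LinearIndependent.of_comp (cycles (sublevel I r)).subtype ?_
        exact W.linearIndependent.comp (fun i : {i : Barcode o // r ∈ i.interval} => i.1.birth)
          fun i j h => Subtype.ext (Barcode.birth_injective h)
      -- Independence descends to the quotient because the span of these cycles meets the boundaries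
      -- trivially.
      refine hlin.map ?_
      rw [Submodule.ker_mkQ, Submodule.disjoint_def]
      intro x hx hx'
      have hmem := Submodule.mem_map_of_mem (f := (cycles (sublevel I r)).subtype) hx
      rw [map_span_barcodeCycle] at hmem
      exact Subtype.ext (Submodule.disjoint_def.1 (disjoint_birth_boundaries hW h1 h0 r) _ hmem hx'))
    (by
      rintro y -
      obtain ⟨x, rfl⟩ := Submodule.mkQ_surjective _ y
      obtain ⟨y, hy, z, hz, hyz⟩ := Submodule.mem_sup.1 (cycles_sublevel_le hW h1 h0 r x.2)
      rw [← map_span_barcodeCycle hW h1 h0] at hy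
      obtain ⟨y, hy, rfl⟩ := hy
      have hxy : ((boundaries (sublevel I r)).submoduleOf (cycles (sublevel I r))).mkQ x =
          ((boundaries (sublevel I r)).submoduleOf (cycles (sublevel I r))).mkQ y := by
        refine (Submodule.Quotient.eq _).2 ?_
        change (x : Chain m n) - y ∈ boundaries (sublevel I r)
        rw [← hyz]
        simpa using hz
      rw [hxy, Set.range_comp' , Submodule.span_image]
      exact Submodule.mem_map_of_mem hy)

theorem barcodeBasis_apply (hW : ∀ c, IsLead o (W c) c)
    (h1 : ∀ c d, IsPair o o c d → boundary m n (W d) = W c)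
    (h0 : ∀ d, (∀ c, ¬ IsPair o o c d) → boundary m n (W d) = 0) (r : ℝ)
    (i : {i : Barcode o // r ∈ i.interval}) :
    barcodeBasis hW h1 h0 r i = ((boundaries (sublevel I r)).submoduleOf
      (cycles (sublevel I r))).mkQ (barcodeCycle hW h1 h0 r i) :=
  Module.Basis.mk_apply _ _ _

end AdaptedBasis

/-- The class of an interval is represented by the same chain at every `r`, so inclusions preserve
it. Once the interval has ended, the chain bounds that of the death cell. -/
theorem persistentHomology_isBarcode (o : CompatibleOrdering I) :
    (persistentHomology I).IsBarcode (Barcode.interval (o := o)) := by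
  obtain ⟨W, hW, h1, h0⟩ := exists_adapted_basis o
  refine ⟨fun i => ⟨i.interval_nonempty, i.interval_ordConnected⟩, barcodeBasis hW h1 h0,
    fun r s h i => ?_⟩
  change (∀ hs, homologyMap (sublevel_mono I h) (barcodeBasis hW h1 h0 r i) =
    barcodeBasis hW h1 h0 s ⟨i, hs⟩) ∧ (_ → homologyMap (sublevel_mono I h)
      (barcodeBasis hW h1 h0 r i) = 0)
  rw [barcodeBasis_apply]
  refine ⟨fun hs => ?_, fun hs => ?_⟩
  · rw [barcodeBasis_apply]
    rfl
  · refine (Submodule.Quotient.mk_eq_zero _).2 ?_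
    change W i.1.birth ∈ boundaries (sublevel I s)
    rw [boundaries_sublevel_eq_span hW h1 h0]
    refine Submodule.subset_span ⟨_, ?_, rfl⟩
    obtain ⟨p | c, hi⟩ := i
    · have hp : ¬ s < filterFunction I p.1.2 := fun hlt => hs ⟨le_trans hi.1 h, hlt⟩
      exact ⟨p.1.2, not_lt.1 hp, p.2.1⟩
    · exact absurd (le_trans hi h) hs

/-! ### The points of the persistence diagram of a binary image -/

theorem filterFunction_binary (hI : ∀ i j, I i j = 0 ∨ I i j = 1) (c : Cell m n) :
    filterFunction I c = 0 ∨ filterFunction I c = 1 := by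
  have hmax : ∀ a b : ℝ, (a = 0 ∨ a = 1) → (b = 0 ∨ b = 1) → (max a b = 0 ∨ max a b = 1) :=
    fun a b ha hb => (max_choice a b).elim (fun h => h.symm ▸ ha) fun h => h.symm ▸ hb
  exact hmax _ _ (hmax _ _ (hI _ _) (hI _ _)) (hmax _ _ (hI _ _) (hI _ _))

/-- Positive length between values 0 and 1 forces `[0, 1)`. Only an essential interval can be born
at 1, and its point is degenerate. -/
theorem Barcode.point_or_of_binary (hI : ∀ i j, I i j = 0 ∨ I i j = 1)
    {o : CompatibleOrdering I} (i : Barcode o) :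
    (i.point = !₂[0, 1] ∧ (0 : ℝ) ∈ i.interval) ∨
      (i.point = !₂[1, 1] ∧ (0 : ℝ) ∉ i.interval) := by
  rcases i with p | c
  · left
    have hlt := p.2.2
    have h : filterFunction I p.1.1 = 0 := by
      rcases filterFunction_binary hI p.1.1 with h | h
      · exact h
      · rcases filterFunction_binary hI p.1.2 with h' | h' <;> linarith
    have h' : filterFunction I p.1.2 = 1 := by
      rcases filterFunction_binary hI p.1.2 with h' | h'
      · linarith
      · exact h'
    exact ⟨by simp only [Barcode.point, h, h'], by simp [Barcode.interval, h, h']⟩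
  · rcases filterFunction_binary hI c.1 with h | h
    · exact .inl ⟨by simp only [Barcode.point, h], by simp [Barcode.interval, h]⟩
    · exact .inr ⟨by simp only [Barcode.point, h], by simp [Barcode.interval, h]⟩

theorem Barcode.mem_diagram_iff (hI : ∀ i j, I i j = 0 ∨ I i j = 1)
    {o : CompatibleOrdering I} (i : Barcode o) :
    i.point 0 < i.point 1 ↔ (0 : ℝ) ∈ i.interval := by
  rcases i.point_or_of_binary hI with ⟨h, h'⟩ | ⟨h, h'⟩ <;> simp [h, h']

theorem DiagramPoint.point_eq (hI : ∀ i j, I i j = 0 ∨ I i j = 1)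
    {o : CompatibleOrdering I} (q : DiagramPoint o) : q.1.point = !₂[0, 1] := by
  rcases q.1.point_or_of_binary hI with ⟨h, -⟩ | ⟨-, h⟩
  · exact h
  · exact absurd ((Barcode.mem_diagram_iff hI q.1).1 q.2) h

theorem card_diagramPoint (hI : ∀ i j, I i j = 0 ∨ I i j = 1) (o : CompatibleOrdering I) :
    Nat.card (DiagramPoint o) = Module.finrank (ZMod 2) (Homology (sublevel I 0)) := by
  obtain ⟨-, b, -⟩ := persistentHomology_isBarcode o
  refine Eq.trans ?_ (Module.finrank_eq_nat_card_basis (b 0)).symm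
  exact Nat.card_congr (Equiv.subtypeEquivRight (Barcode.mem_diagram_iff hI))

/-! ### The Betti matching is a matching -/

theorem essentialRank_lt (o : CompatibleOrdering I) {c d : EssentialBar o}
    (hdim : c.1.dim = d.1.dim) (h : o.pos c.1 < o.pos d.1) :
    essentialRank o c.1 < essentialRank o d.1 := by
  refine Set.ncard_lt_ncard ⟨fun e he => ⟨he.1.trans hdim, he.2.trans h⟩, fun hsub => ?_⟩
    (Set.toFinite _)
  have hc : c ∈ {e : EssentialBar o | e.1.dim = c.1.dim ∧ o.pos e.1 < o.pos c.1} :=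
    hsub ⟨hdim, h⟩
  exact lt_irrefl _ hc.2

theorem essentialRank_injective (o : CompatibleOrdering I) {c d : EssentialBar o}
    (hdim : c.1.dim = d.1.dim) (h : essentialRank o c.1 = essentialRank o d.1) : c = d := by
  rcases lt_trichotomy (o.pos c.1) (o.pos d.1) with hlt | he | hlt
  · exact absurd h (essentialRank_lt o hdim hlt).ne
  · exact Subtype.ext (o.pos.injective he)
  · exact absurd h (essentialRank_lt o hdim.symm hlt).ne'

/-- In the mixed reduction the birth cell and the death cell determine each other. The interval of
`I` is then determined by its birth cell and that of `J` by its death cell; essential intervals are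
determined by degree and rank. -/
theorem inducedMatching_biUnique (o : CompatibleOrdering I) (o' : CompatibleOrdering J) :
    Relator.BiUnique (inducedMatching o o') := by
  constructor
  · rintro (p | c) (p' | c') (q | d) h h' <;> try exact h.elim
    all_goals try exact h'.elim
    · have h1 : p.1.1 = p'.1.1 := isPair_left_unique o o' h h'
      exact Barcode.birth_injective (a₁ := .inl p) (a₂ := .inl p') h1
    · exact congrArg _ (essentialRank_injective o (h.1.trans h'.1.symm) (h.2.trans h'.2.symm))
  · rintro (p | c) (q | d) (q' | d') h h' <;> try exact h.elim
    all_goals try exact h'.elim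
    · have h1 : q.1.2 = q'.1.2 := isPair_right_unique o o' h h'
      have h2 : q.1.1 = q'.1.1 := isPair_left_unique o' o' q.2.1 (h1 ▸ q'.2.1)
      exact congrArg _ (Subtype.ext (Prod.ext h2 h1))
    · exact congrArg _ (essentialRank_injective o' (h.1.symm.trans h'.1) (h.2.symm.trans h'.2))

theorem bettiMatching_biUnique (oL : CompatibleOrdering L) (oG : CompatibleOrdering G)
    (oC : CompatibleOrdering (comparison L G)) : Relator.BiUnique (bettiMatching oL oG oC) := by
  have hL := inducedMatching_biUnique oL oC
  have hG := inducedMatching_biUnique oG oC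
  constructor
  · rintro a a' b ⟨c, h1, h2⟩ ⟨c', h1', h2'⟩
    obtain rfl := hG.2 h2 h2'
    exact hL.1 h1 h1'
  · rintro a b b' ⟨c, h1, h2⟩ ⟨c', h1', h2'⟩
    obtain rfl := hL.2 h1 h1'
    exact hG.1 h2 h2'

theorem diagramMatching_biUnique (oL : CompatibleOrdering L) (oG : CompatibleOrdering G)
    (oC : CompatibleOrdering (comparison L G)) :
    Relator.BiUnique (diagramMatching oL oG oC) :=
  ⟨fun _ _ _ h h' => Subtype.ext ((bettiMatching_biUnique oL oG oC).1 h h'),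
    fun _ _ _ h h' => Subtype.ext ((bettiMatching_biUnique oL oG oC).2 h h')⟩

/-! ### Bijections of persistence diagrams -/

/-- A countable set can be absorbed by the copies of a point of the diagonal. -/
theorem exists_absorb (K : Type) [Countable K] (a : ℝ) :
    ∃ E : K ⊕ (ℝ × ℕ) ≃ ℝ × ℕ, (∀ k, (E (.inl k)).1 = a) ∧ ∀ x, (E (.inr x)).1 = x.1 := by
  classical
  obtain ⟨ψ⟩ : Nonempty (K ⊕ ℕ ≃ ℕ) := nonempty_equiv_of_countable
  -- Only the copies of `a` are renumbered, as in Hilbert's hotel; all other fibres stay fixed.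
  let f : K ⊕ (ℝ × ℕ) → ℝ × ℕ := Sum.elim (fun k => (a, ψ (.inl k)))
    fun x => if x.1 = a then (a, ψ (.inr x.2)) else x
  have hf : ∀ x, (f (.inr x)).1 = x.1 := fun x => by
    simp only [f, Sum.elim_inr]
    split_ifs with h
    · exact h.symm
    · rfl
  refine ⟨Equiv.ofBijective f ⟨?_, ?_⟩, fun k => rfl, hf⟩
  · rintro (k | ⟨x, l⟩) (k' | ⟨x', l'⟩) h
    · simpa [f] using h
    · have hx : a = x' := (congrArg Prod.fst h).trans (hf (x', l'))
      simp [f, hx.symm] at h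
    · have hx : x = a := (hf (x, l)).symm.trans (congrArg Prod.fst h)
      simp [f, hx] at h
    · obtain rfl : x = x' := (hf (x, l)).symm.trans ((congrArg Prod.fst h).trans (hf (x', l')))
      by_cases hx : x = a <;> simpa [f, hx] using h
  · rintro ⟨x, l⟩
    by_cases hx : x = a
    · obtain ⟨k | l', hk⟩ := ψ.surjective l
      · exact ⟨.inl k, by simp [f, hx, hk]⟩
      · exact ⟨.inr (a, l'), by simp [f, hx, hk]⟩
    · exact ⟨.inr (x, l), by simp [f, hx]⟩

theorem exists_of_notMem_matchingKer {X Y : Type} {τ : X → Y → Prop} {x : X}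
    (h : x ∉ matchingKer τ) : ∃ y, τ x y := by
  by_contra hn
  exact h (not_exists.1 hn)

theorem exists_of_notMem_matchingCoker {X Y : Type} {τ : X → Y → Prop} {y : Y}
    (h : y ∉ matchingCoker τ) : ∃ x, τ x y := by
  by_contra hn
  exact h (not_exists.1 hn)

/-- The bijection between the matched elements of a matching. -/
theorem exists_matched_equiv {X Y : Type} {τ : X → Y → Prop} (hτ : Relator.BiUnique τ) :
    ∃ M : {x // x ∉ matchingKer τ} ≃ {y // y ∉ matchingCoker τ}, ∀ x, τ x.1 (M x).1 := by
  have hX : ∀ x : {x // x ∉ matchingKer τ}, ∃ y : {y // y ∉ matchingCoker τ}, τ x.1 y.1 := by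
    intro x
    obtain ⟨y, hy⟩ : ∃ y, τ x.1 y := exists_of_notMem_matchingKer x.2
    exact ⟨⟨y, fun h => h x.1 hy⟩, hy⟩
  choose f hf using hX
  refine ⟨Equiv.ofBijective f ⟨fun x x' h => ?_, fun y => ?_⟩, hf⟩
  · exact Subtype.ext (hτ.1 (hf x) (h ▸ hf x'))
  · obtain ⟨x, hx⟩ : ∃ x, τ x y.1 := exists_of_notMem_matchingCoker y.2
    have hx' : x ∉ matchingKer τ := fun h => h y.1 hx
    exact ⟨⟨x, hx'⟩, Subtype.ext (hτ.2 (hf ⟨x, hx'⟩) hx)⟩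

/-- The common midpoint `a` lets the copies of a single diagonal point serve all unmatched points of
both diagrams. -/
theorem exists_isDiagramBijection {oL : CompatibleOrdering L} {oG : CompatibleOrdering G}
    {τ : DiagramPoint oL → DiagramPoint oG → Prop} (hτ : Relator.BiUnique τ) {a : ℝ}
    (hL : ∀ q : DiagramPoint oL, q.mid = a) (hG : ∀ q : DiagramPoint oG, q.mid = a) :
    ∃ e : Diagram oL ≃ Diagram oG, IsDiagramBijection τ e := by
  classical
  obtain ⟨M, hM⟩ := exists_matched_equiv hτ
  obtain ⟨EK, hEK1, hEK2⟩ := exists_absorb (matchingKer τ) a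
  obtain ⟨EC, hEC1, hEC2⟩ := exists_absorb (matchingCoker τ) a
  -- The off-diagonal points split into matched and kernel points, and the diagonal splits via `EC`
  -- into the cokernel and a new diagonal. Matched points and cokernel form the off-diagonal part of
  -- the target, while `EK` merges the kernel with the new diagonal.
  let e : Diagram oL ≃ Diagram oG :=
    ((Equiv.sumCongr ((Equiv.sumCompl (· ∈ matchingKer τ)).symm.trans (Equiv.sumComm _ _))
      EC.symm).trans (Equiv.sumSumSumComm _ _ _ _)).trans
      (Equiv.sumCongr ((Equiv.sumCongr M (Equiv.refl _)).trans
        ((Equiv.sumComm _ _).trans (Equiv.sumCompl (· ∈ matchingCoker τ)))) EK)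
  refine ⟨e, fun q q' h => ?_, fun q hq => ?_, fun q' hq' => ?_, fun x k y l h => ?_⟩
  · have hq : q ∉ matchingKer τ := fun hk => hk q' h
    have : e (.inl q) = .inl (M ⟨q, hq⟩).1 := by
      simp [e, Equiv.sumCompl_symm_apply_of_neg hq]
    rw [this, hτ.2 (hM ⟨q, hq⟩) h]
  · have : e (.inl q) = .inr (EK (.inl ⟨q, hq⟩)) := by
      simp [e, Equiv.sumCompl_symm_apply_of_pos hq]
    exact ⟨(EK (.inl ⟨q, hq⟩)).2, by rw [this, hL, ← hEK1 ⟨q, hq⟩]⟩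
  · have : e (.inr (EC (.inl ⟨q', hq'⟩))) = .inl q' := by simp [e]
    exact ⟨(EC (.inl ⟨q', hq'⟩)).2, by rw [hG, ← hEC1 ⟨q', hq'⟩, ← this]⟩
  · obtain ⟨c | z, hz⟩ := EC.surjective (x, k)
    · have : e (.inr (x, k)) = .inl c.1 := by rw [← hz]; simp [e]
      rw [this] at h
      cases h
    · have : e (.inr (x, k)) = .inr (EK (.inr z)) := by rw [← hz]; simp [e]
      have h1 : EK (.inr z) = (y, l) := Sum.inr.inj (this.symm.trans h)
      have h2 := hEK2 z
      have h3 := hEC2 z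
      rw [h1] at h2
      rw [hz] at h3
      exact h2.trans h3.symm

theorem DiagramPoint.mid_eq {o : CompatibleOrdering I}
    (h : ∀ q : DiagramPoint o, q.1.point = !₂[0, 1]) (q : DiagramPoint o) : q.mid = 1 / 2 := by
  unfold DiagramPoint.mid
  rw [h q]
  simp

/-! ### The value of the loss. -/

section Contribution

variable {oL : CompatibleOrdering L} {oG : CompatibleOrdering G}
  {τ : DiagramPoint oL → DiagramPoint oG → Prop} {e : Diagram oL ≃ Diagram oG}

theorem contribution_of_mem_ker
    (hL : ∀ q : DiagramPoint oL, q.1.point = !₂[0, 1]) (he : IsDiagramBijection τ e) {q : DiagramPoint oL}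
    (hq : q ∈ matchingKer τ) : contribution e (.inl q) = 1 := by
  obtain ⟨k, hk⟩ := he.unmatched_left q hq
  unfold contribution
  rw [hk, EuclideanSpace.norm_sq_eq]
  simp only [Diagram.point, hL q, DiagramPoint.mid_eq hL]
  simp [Fin.sum_univ_two]
  norm_num

theorem contribution_of_mem_coker
    (hG : ∀ q : DiagramPoint oG, q.1.point = !₂[0, 1]) (he : IsDiagramBijection τ e) {q' : DiagramPoint oG}
    (hq' : q' ∈ matchingCoker τ) : contribution e (e.symm (.inl q')) = 1 := by
  obtain ⟨k, hk⟩ := he.unmatched_right q' hq'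
  have hs : e.symm (.inl q') = .inr (q'.mid, k) := by rw [← hk, Equiv.symm_apply_apply]
  unfold contribution
  rw [Equiv.apply_symm_apply, hs, EuclideanSpace.norm_sq_eq]
  simp only [Diagram.point, hG q', DiagramPoint.mid_eq hG]
  simp [Fin.sum_univ_two]
  norm_num

theorem contribution_of_matched
    (hL : ∀ q : DiagramPoint oL, q.1.point = !₂[0, 1])
    (hG : ∀ q : DiagramPoint oG, q.1.point = !₂[0, 1]) (he : IsDiagramBijection τ e) {q : DiagramPoint oL}
    {q' : DiagramPoint oG} (h : τ q q') : contribution e (.inl q) = 0 := by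
  unfold contribution
  rw [he.matched q q' h]
  simp [Diagram.point, hL q, hG q']

/-- All but finitely many summands vanish: the support consists of the kernel points and of the
diagonal points sent to the cokernel. -/
theorem hasSum_contribution
    (hL : ∀ q : DiagramPoint oL, q.1.point = !₂[0, 1])
    (hG : ∀ q : DiagramPoint oG, q.1.point = !₂[0, 1]) (he : IsDiagramBijection τ e) :
    HasSum (contribution e)
      (((matchingKer τ).ncard + (matchingCoker τ).ncard : ℕ) : ℝ) := by
  classical
  let A : Set (Diagram oL) := Sum.inl '' matchingKer τ
  let B : Set (Diagram oL) := (fun q' => e.symm (.inl q')) '' matchingCoker τ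
  have hA : A.ncard = (matchingKer τ).ncard := Set.ncard_image_of_injective _ Sum.inl_injective
  have hB : B.ncard = (matchingCoker τ).ncard :=
    Set.ncard_image_of_injective _ (e.symm.injective.comp Sum.inl_injective)
  have hAfin : A.Finite := (Set.toFinite _).image _
  have hBfin : B.Finite := (Set.toFinite _).image _
  have hAB : Disjoint A B := by
    rw [Set.disjoint_left]
    rintro _ ⟨q, hq, rfl⟩ ⟨q', -, h⟩
    obtain ⟨k, hk⟩ := he.unmatched_left q hq
    have h' : (Sum.inl q' : Diagram oG) = .inr (q.mid, k) := by
      rw [← hk, ← h, Equiv.apply_symm_apply]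
    cases h'
  have hfin : (A ∪ B).Finite := hAfin.union hBfin
  have hone : ∀ q ∈ hfin.toFinset, contribution e q = 1 := by
    intro q hq
    rcases hfin.mem_toFinset.1 hq with ⟨p, hp, rfl⟩ | ⟨q', hq', rfl⟩
    · exact contribution_of_mem_ker hL he hp
    · exact contribution_of_mem_coker hG he hq'
  have hzero : ∀ q ∉ hfin.toFinset, contribution e q = 0 := by
    intro q hq
    rw [hfin.mem_toFinset] at hq
    rcases q with q | ⟨x, k⟩
    · have hq' : q ∉ matchingKer τ := fun h => hq (.inl ⟨q, h, rfl⟩)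
      obtain ⟨q', h⟩ : ∃ q', τ q q' := exists_of_notMem_matchingKer hq'
      exact contribution_of_matched hL hG he h
    · rcases hx : e (.inr (x, k)) with q' | ⟨y, l⟩
      · by_cases hq' : q' ∈ matchingCoker τ
        · exact absurd (Or.inr ⟨q', hq', (e.symm_apply_eq).2 hx.symm⟩) hq
        · obtain ⟨q, h⟩ : ∃ q, τ q q' := exists_of_notMem_matchingCoker hq'
          -- A matched `q'` is already the image of an off-diagonal point, so no diagonal point can
          -- map to it.
          have := e.injective ((he.matched q q' h).trans hx.symm)
          cases this
      · obtain rfl := he.diagonal x k y l hx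
        unfold contribution
        rw [hx]
        simp [Diagram.point]
  have hsum : HasSum (contribution e) _ := hasSum_sum_of_ne_finset_zero hzero
  rw [Finset.sum_congr rfl hone, Finset.sum_const, nsmul_one, ← Set.ncard_eq_toFinset_card _ hfin,
    Set.ncard_union_eq hAB hAfin hBfin, hA, hB] at hsum
  exact hsum

end Contribution

end BettiMatching

end

open BettiMatching in
theorem mainTheorem1 (m n : ℕ) (P G : Matrix (Fin m) (Fin n) ℝ)
    (hP : ∀ i j, P i j = 0 ∨ P i j = 1) (hG : ∀ i j, G i j = 0 ∨ G i j = 1)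
    (oP : CompatibleOrdering P) (oG : CompatibleOrdering G)
    (oC : CompatibleOrdering (comparison P G)) :
    -- the barcodes are those of the persistent homology of the images
    ((persistentHomology P).IsBarcode (Barcode.interval (o := oP)) ∧
      (persistentHomology G).IsBarcode (Barcode.interval (o := oG))) ∧
    -- every off-diagonal point of the persistence diagrams is `(0, 1)`
    ((∀ q : DiagramPoint oP, q.1.point = !₂[0, 1]) ∧
      (∀ q : DiagramPoint oG, q.1.point = !₂[0, 1])) ∧
    -- the number of off-diagonal points is the number of topological features of the foreground
    (Nat.card (DiagramPoint oP) = Module.finrank (ZMod 2) (Homology (sublevel P 0)) ∧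
      Nat.card (DiagramPoint oG) = Module.finrank (ZMod 2) (Homology (sublevel G 0))) ∧
    -- the Betti matching is a matching
    Relator.BiUnique (bettiMatching oP oG oC) ∧
    -- unmatched points contribute `1` each, matched pairs contribute `0`
    (∀ e : Diagram oP ≃ Diagram oG, IsDiagramBijection (diagramMatching oP oG oC) e →
      (∀ q ∈ matchingKer (diagramMatching oP oG oC), contribution e (.inl q) = 1) ∧
      (∀ q' ∈ matchingCoker (diagramMatching oP oG oC), contribution e (e.symm (.inl q')) = 1) ∧
      (∀ q q', diagramMatching oP oG oC q q' → contribution e (.inl q) = 0)) ∧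
    -- the Betti matching error is the number of unmatched points
    (∀ x : ℝ, IsBettiMatchingLoss oP oG oC x ↔
      x = (((matchingKer (diagramMatching oP oG oC)).ncard +
        (matchingCoker (diagramMatching oP oG oC)).ncard : ℕ) : ℝ)) := by
  have hPp := DiagramPoint.point_eq hP (o := oP)
  have hGp := DiagramPoint.point_eq hG (o := oG)
  refine ⟨⟨persistentHomology_isBarcode oP, persistentHomology_isBarcode oG⟩, ⟨hPp, hGp⟩,
    ⟨card_diagramPoint hP oP, card_diagramPoint hG oG⟩, bettiMatching_biUnique oP oG oC,
    fun e he => ⟨fun q hq => contribution_of_mem_ker hPp he hq,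
      fun q' hq' => contribution_of_mem_coker hGp he hq',
      fun q q' h => contribution_of_matched hPp hGp he h⟩, fun x => ⟨?_, ?_⟩⟩
  -- The sum is the same for every admissible bijection, so the loss does not depend on the choice.
  · rintro ⟨e, he, hx⟩
    exact hx.unique (hasSum_contribution hPp hGp he)
  · rintro rfl
    obtain ⟨e, he⟩ := exists_isDiagramBijection (diagramMatching_biUnique oP oG oC)
      (DiagramPoint.mid_eq hPp) (DiagramPoint.mid_eq hGp)
    exact ⟨e, he, hasSum_contribution hPp hGp he⟩
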